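/- Let $G$ be a finite group with subgroups $G_+,G_-$ forming a unique factorization $G=G_+G_-$: every $g\in G$ is $g=g_+g_-$ for unique $g_+\in G_+$, $g_-\in G_-$. Equivalently every $g\in G$ is $g=\bar g_-\bar g_+$ for unique $\bar g_\pm\in G_\pm$. For $u\in G_+$ and $x\in G_-$ define ${}^u x,\ x^u\in G_-$ and $u^x,\ {}^x u\in G_+$ by $ux=({}^u x)(u^x)$ and $xu=({}^x u)(x^u)$. Let $H=H(G;G_+,G_-)$ be the bicrossproduct Hopf algebra: the complex vector space with basis $\{g\}$, $g\in G$, and $$\{g\}\{h\}=\delta_{g_+^{\,g_-},\,h_+}\{gh_-\},\qquad 1=\sum_{u\in G_+}\{u\},\qquad \Delta\{g\}=\sum_{u\in G_+}\{g_+u^{-1}({}^{u}g_-)\}\otimes\{u g_-\},$$ $$\varepsilon\{g\}=\delta_{g_+,e},\qquad S\{g\}=\{g^{-1}\}.$$ A quasi-triangular structure on $H$ is an invertible $R\in H\otimes H$ such that $\tau\Delta(a)=R\,\Delta(a)R^{-1}$ for all $a\in H$, where $\tau(a\otimes b)=b\otimes a$, and $(\Delta\otimes\mathrm{id})R=R_{13}R_{23}$,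 $(\mathrm{id}\otimes\Delta)R=R_{13}R_{12}$, $(\varepsilon\otimes\mathrm{id})R=(\mathrm{id}\otimes\varepsilon)R=1$. It is positive if all its coefficients in the basis $\{g\}\otimes\{h\}$, $g,h\in G$, are non-negative real numbers. (1) Let $\xi,\eta:G_+\to G_-$ be group homomorphisms such that (a) $G_+'=\{u\,\xi(u^{-1}):u\in G_+\}$ and $G_+''=\{\eta(u^{-1})\,u:u\in G_+\}$ are normal subgroups of $G$; (b) the map $F:G_+'\to G_+''$, $F(u\,\xi(u^{-1}))=\eta(u)\,u^{-1}$, is a group isomorphism. Then $$R=\sum_{u,v\in G_+}\{u\,(\eta(v)^{u})^{-1}\}\otimes\{v\,\xi(u)\}$$ is a positive quasi-triangular structure on $H$. (2) Conversely, for every positive quasi-triangular structure $R$ on $H$ there are group homomorphisms $\xi,\eta:G_+\to G_-$ satisfying (a) and (b) such that $R$ is given by the formula in (1); in particular all non-zero coefficients of $R$ are equal to $1$. -/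

import Mathlib

open scoped TensorProduct

namespace UniqueFactorization

variable {G : Type*} [Group G] {Gp Gm : Subgroup G}

/-! Throughout, `h : Gp.IsComplement' Gm` says that every `g : G` is `g = g₊ g₋` for unique
`g₊ ∈ Gp`, `g₋ ∈ Gm`. -/

/-- The factor `g₊` of `g = g₊ g₋`. -/
noncomputable def pos (h : Gp.IsComplement' Gm) (g : G) : Gp :=
  ⟨((Subgroup.IsComplement.equiv h) g).1, ((Subgroup.IsComplement.equiv h) g).1.2⟩

/-- The factor `g₋` of `g = g₊ g₋`. -/
noncomputable def neg (h : Gp.IsComplement' Gm) (g : G) : Gm :=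
  ⟨((Subgroup.IsComplement.equiv h) g).2, ((Subgroup.IsComplement.equiv h) g).2.2⟩

/-- The factor `ḡ₊` of `g = ḡ₋ ḡ₊`. -/
noncomputable def posBar (h : Gp.IsComplement' Gm) (g : G) : Gp := (pos h g⁻¹)⁻¹

/-- The factor `ḡ₋` of `g = ḡ₋ ḡ₊`. -/
noncomputable def negBar (h : Gp.IsComplement' Gm) (g : G) : Gm := (neg h g⁻¹)⁻¹

theorem pos_mul_neg (h : Gp.IsComplement' Gm) (g : G) : (pos h g : G) * neg h g = g :=
  Subgroup.IsComplement.equiv_fst_mul_equiv_snd h g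

theorem negBar_mul_posBar (h : Gp.IsComplement' Gm) (g : G) :
    (negBar h g : G) * posBar h g = g := by
  have := congrArg (·⁻¹) (pos_mul_neg h g⁻¹)
  simpa [negBar, posBar] using this

theorem eq_of_mul_eq (h : Gp.IsComplement' Gm) {u v : Gp} {x y : Gm}
    (e : (u : G) * x = v * y) : u = v ∧ x = y := by
  have := h.1 (a₁ := (⟨u, u.2⟩, ⟨x, x.2⟩)) (a₂ := (⟨v, v.2⟩, ⟨y, y.2⟩)) e
  simp only [Prod.mk.injEq, Subtype.mk.injEq] at this
  exact ⟨Subtype.ext this.1, Subtype.ext this.2⟩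

theorem eq_of_mul_eq' (h : Gp.IsComplement' Gm) {u v : Gp} {x y : Gm}
    (e : (x : G) * u = y * v) : u = v ∧ x = y := by
  have e' : ((u⁻¹ : Gp) : G) * (x⁻¹ : Gm) = (v⁻¹ : Gp) * (y⁻¹ : Gm) := by
    have := congrArg (·⁻¹) e
    simpa using this
  simpa using eq_of_mul_eq h e'

@[simp] theorem pos_coe_mul_coe (h : Gp.IsComplement' Gm) (u : Gp) (x : Gm) : pos h (u * x) = u :=
  (eq_of_mul_eq h (pos_mul_neg h (u * x))).1

@[simp] theorem neg_coe_mul_coe (h : Gp.IsComplement' Gm) (u : Gp) (x : Gm) : neg h (u * x) = x :=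
  (eq_of_mul_eq h (pos_mul_neg h (u * x))).2

@[simp] theorem posBar_coe_mul_coe (h : Gp.IsComplement' Gm) (u : Gp) (x : Gm) :
    posBar h (x * u) = u :=
  (eq_of_mul_eq' h (negBar_mul_posBar h (x * u))).1

@[simp] theorem negBar_coe_mul_coe (h : Gp.IsComplement' Gm) (u : Gp) (x : Gm) :
    negBar h (x * u) = x :=
  (eq_of_mul_eq' h (negBar_mul_posBar h (x * u))).2

@[simp] theorem pos_coe (h : Gp.IsComplement' Gm) (u : Gp) : pos h (u : G) = u := by
  simpa using pos_coe_mul_coe h u 1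

@[simp] theorem neg_coe (h : Gp.IsComplement' Gm) (u : Gp) : neg h (u : G) = 1 := by
  simpa using neg_coe_mul_coe h u 1

@[simp] theorem posBar_coe (h : Gp.IsComplement' Gm) (u : Gp) : posBar h (u : G) = u := by
  simpa using posBar_coe_mul_coe h u 1

/-- The right action `u ^ x` of `Gm` on `Gp`; `u x = (^u x) (u ^ x)`. -/
noncomputable def posRight (h : Gp.IsComplement' Gm) (u : Gp) (x : Gm) : Gp :=
  posBar h ((u : G) * x)

/-- The left action `^u x` of `Gp` on `Gm`; `u x = (^u x) (u ^ x)`. -/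
noncomputable def negLeft (h : Gp.IsComplement' Gm) (u : Gp) (x : Gm) : Gm :=
  negBar h ((u : G) * x)

/-- The right action `x ^ u` of `Gp` on `Gm`; `x u = (^x u) (x ^ u)`. -/
noncomputable def negRight (h : Gp.IsComplement' Gm) (x : Gm) (u : Gp) : Gm :=
  neg h ((x : G) * u)

theorem negLeft_mul_posRight (h : Gp.IsComplement' Gm) (u : Gp) (x : Gm) :
    (negLeft h u x : G) * posRight h u x = u * x :=
  negBar_mul_posBar h _

theorem act_unique (h : Gp.IsComplement' Gm) {u v : Gp} {x y : Gm}
    (e : (y : G) * v = u * x) : negLeft h u x = y ∧ posRight h u x = v := by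
  have := eq_of_mul_eq' h ((negLeft_mul_posRight h u x).trans e.symm)
  exact ⟨this.2, this.1⟩

theorem act_one (h : Gp.IsComplement' Gm) (u : Gp) :
    negLeft h u 1 = 1 ∧ posRight h u 1 = u :=
  act_unique h (by simp)

theorem one_act (h : Gp.IsComplement' Gm) (x : Gm) :
    negLeft h 1 x = x ∧ posRight h 1 x = 1 :=
  act_unique h (by simp)

theorem mul_act (h : Gp.IsComplement' Gm) (u v : Gp) (x : Gm) :
    negLeft h (u * v) x = negLeft h u (negLeft h v x) ∧
      posRight h (u * v) x = posRight h u (negLeft h v x) * posRight h v x := by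
  apply act_unique h
  have h1 := negLeft_mul_posRight h u (negLeft h v x)
  have h2 := negLeft_mul_posRight h v x
  push_cast
  rw [← mul_assoc, h1, mul_assoc, h2, mul_assoc]

theorem act_mul (h : Gp.IsComplement' Gm) (u : Gp) (x y : Gm) :
    negLeft h u (x * y) = negLeft h u x * negLeft h (posRight h u x) y ∧
      posRight h u (x * y) = posRight h (posRight h u x) y := by
  apply act_unique h
  have h1 := negLeft_mul_posRight h u x
  have h2 := negLeft_mul_posRight h (posRight h u x) y
  push_cast
  rw [mul_assoc, h2, ← mul_assoc, h1, mul_assoc]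

theorem posRight_bijective (h : Gp.IsComplement' Gm) (x : Gm) :
    Function.Bijective fun u : Gp => posRight h u x := by
  refine Function.bijective_iff_has_inverse.2 ⟨fun u => posRight h u x⁻¹, fun u => ?_, fun u => ?_⟩
  · simp only [← (act_mul h _ _ _).2, mul_inv_cancel, (act_one h _).2]
  · simp only [← (act_mul h _ _ _).2, inv_mul_cancel, (act_one h _).2]

theorem exists_eq (h : Gp.IsComplement' Gm) (g : G) : ∃ (u : Gp) (x : Gm), g = u * x :=
  ⟨pos h g, neg h g, (pos_mul_neg h g).symm⟩

theorem inv_act (h : Gp.IsComplement' Gm) (v : Gp) (x : Gm) :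
    posRight h (posRight h v x)⁻¹ (negLeft h v x)⁻¹ = v⁻¹ := by
  refine (act_unique h (y := x⁻¹) ?_).2
  have := congrArg (·⁻¹) (negLeft_mul_posRight h v x)
  simpa using this.symm

theorem posRight_eq_one (h : Gp.IsComplement' Gm) (v : Gp) (x : Gm) :
    posRight h v x = 1 ↔ v = 1 :=
  ⟨fun e => (posRight_bijective h x).1 (e.trans (one_act h x).2.symm),
    fun e => e ▸ (one_act h x).2⟩

end UniqueFactorization

/-- The underlying space of `H(G; Gp, Gm)`: the complex vector space with basis `G`. -/
def Bicrossproduct {G : Type*} [Group G] {Gp Gm : Subgroup G}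
    (_h : Gp.IsComplement' Gm) : Type _ := G →₀ ℂ

namespace Bicrossproduct

open UniqueFactorization

section Structure

variable {G : Type*} [Group G] {Gp Gm : Subgroup G} (h : Gp.IsComplement' Gm)

noncomputable instance : AddCommGroup (Bicrossproduct h) := inferInstanceAs (AddCommGroup (G →₀ ℂ))

noncomputable instance : Module ℂ (Bicrossproduct h) := inferInstanceAs (Module ℂ (G →₀ ℂ))

/-- The basis `{g}`, `g ∈ G`, of `H(G; Gp, Gm)`. -/
noncomputable def basis : Module.Basis G ℂ (Bicrossproduct h) :=
  Module.Basis.ofRepr (LinearEquiv.refl ℂ (G →₀ ℂ))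

variable {h} in
theorem induct {P : Bicrossproduct h → Prop} (a : Bicrossproduct h)
    (hadd : ∀ a b, P a → P b → P (a + b)) (hsmul : ∀ (c : ℂ) a, P a → P (c • a))
    (hof : ∀ g, P (basis h g)) : P a := by
  have ha : a ∈ Submodule.span ℂ (Set.range (basis h)) := by simp [(basis h).span_eq]
  refine Submodule.span_induction (p := fun a _ => P a) ?_ ?_ ?_ ?_ ha
  · rintro _ ⟨g, rfl⟩; exact hof g
  · simpa using hsmul 0 _ (hof 1)
  · intro a b _ _; exact hadd a b
  · intro c a _; exact hsmul c a

open Classical in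
/-- Multiplication: `{g}{k} = δ(g₊ ^ g₋, k₊) {g k₋}`. -/
noncomputable def mulLin :
    Bicrossproduct h →ₗ[ℂ] Bicrossproduct h →ₗ[ℂ] Bicrossproduct h :=
  (basis h).constr ℂ fun g => (basis h).constr ℂ fun k =>
    if posRight h (pos h g) (neg h g) = pos h k then basis h (g * neg h k) else 0

noncomputable instance : Mul (Bicrossproduct h) := ⟨fun a b => mulLin h a b⟩

theorem mul_def (a b : Bicrossproduct h) : a * b = mulLin h a b := rfl

open Classical in
theorem basis_mul_basis (g k : G) : basis h g * basis h k =
    if posRight h (pos h g) (neg h g) = pos h k then basis h (g * neg h k) else 0 := by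
  simp [mul_def, mulLin]

open Classical in
theorem basis_mul_basis' (u v : Gp) (x y : Gm) :
    basis h ((u : G) * x) * basis h ((v : G) * y) =
    if posRight h u x = v then basis h ((u : G) * (x * y : Gm)) else 0 := by
  simp [basis_mul_basis, mul_assoc]

noncomputable instance : NonUnitalNonAssocRing (Bicrossproduct h) :=
  { (inferInstance : AddCommGroup (Bicrossproduct h)) with
    mul := (· * ·)
    left_distrib := fun a b c => by simp [mul_def]
    right_distrib := fun a b c => by simp [mul_def]
    zero_mul := fun a => by simp [mul_def]
    mul_zero := fun a => by simp [mul_def] }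

theorem smul_mul' (c : ℂ) (a b : Bicrossproduct h) : c • a * b = c • (a * b) := by
  simp [mul_def]

theorem mul_smul' (c : ℂ) (a b : Bicrossproduct h) : a * c • b = c • (a * b) := by
  simp [mul_def]

theorem mul_assoc' (a b c : Bicrossproduct h) : a * b * c = a * (b * c) := by
  induction a using induct with
  | hadd a a' ha ha' => rw [add_mul, add_mul, ha, ha', add_mul]
  | hsmul r a ha => rw [smul_mul', smul_mul', ha, smul_mul']
  | hof g =>
  induction b using induct with
  | hadd a a' ha ha' => rw [mul_add, add_mul, ha, ha', add_mul, mul_add]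
  | hsmul r a ha => rw [mul_smul', smul_mul', ha, smul_mul', mul_smul']
  | hof k =>
  induction c using induct with
  | hadd a a' ha ha' => rw [mul_add, ha, ha', mul_add, mul_add]
  | hsmul r a ha => rw [mul_smul', ha, mul_smul', mul_smul']
  | hof l =>
    obtain ⟨u, x, rfl⟩ := exists_eq h g
    obtain ⟨v, y, rfl⟩ := exists_eq h k
    obtain ⟨w, z, rfl⟩ := exists_eq h l
    by_cases h1 : posRight h u x = v <;> by_cases h2 : posRight h v y = w <;>
      simp only [basis_mul_basis', h1, h2, (act_mul h _ _ _).2, mul_assoc, if_true, if_false,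
        zero_mul, mul_zero]

end Structure

section Hopf

attribute [local instance] Fintype.ofFinite

variable {G : Type*} [Group G] [Finite G] {Gp Gm : Subgroup G} (h : Gp.IsComplement' Gm)

/-- Unit: `1 = ∑ {u}` over `u ∈ Gp`. -/
noncomputable instance : One (Bicrossproduct h) := ⟨∑ u : Gp, basis h (u : G)⟩

theorem one_def : (1 : Bicrossproduct h) = ∑ u : Gp, basis h (u : G) := rfl

theorem one_mul' (a : Bicrossproduct h) : 1 * a = a := by
  classical
  induction a using induct with
  | hadd a a' ha ha' => rw [mul_add, ha, ha']
  | hsmul r a ha => rw [mul_smul', ha]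
  | hof g =>
    simp [one_def, Finset.sum_mul, basis_mul_basis, (act_one h _).2, pos_mul_neg]

theorem mul_one' (a : Bicrossproduct h) : a * 1 = a := by
  classical
  induction a using induct with
  | hadd a a' ha ha' => rw [add_mul, ha, ha']
  | hsmul r a ha => rw [smul_mul', ha]
  | hof g =>
    simp [one_def, Finset.mul_sum, basis_mul_basis]

noncomputable instance : Ring (Bicrossproduct h) :=
  { (inferInstance : NonUnitalNonAssocRing (Bicrossproduct h)) with
    one := 1
    one_mul := one_mul' h
    mul_one := mul_one' h
    mul_assoc := mul_assoc' h }

noncomputable instance : Algebra ℂ (Bicrossproduct h) :=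
  Algebra.ofModule (smul_mul' h) (mul_smul' h)

/-- Comultiplication: `Δ{g} = ∑ {g₊ u⁻¹ (^u g₋)} ⊗ {u g₋}` over `u ∈ Gp`. -/
noncomputable def comulLin : Bicrossproduct h →ₗ[ℂ] Bicrossproduct h ⊗[ℂ] Bicrossproduct h :=
  (basis h).constr ℂ fun g => ∑ u : Gp,
    basis h ((pos h g : G) * (u : G)⁻¹ * negLeft h u (neg h g)) ⊗ₜ[ℂ] basis h ((u : G) * neg h g)

open Classical in
/-- Counit: `ε{g} = δ(g₊, e)`. -/
noncomputable def counitLin : Bicrossproduct h →ₗ[ℂ] ℂ :=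
  (basis h).constr ℂ fun g => if pos h g = 1 then 1 else 0

/-- Antipode: `S{g} = {g⁻¹}`. -/
noncomputable def antipodeLin : Bicrossproduct h →ₗ[ℂ] Bicrossproduct h :=
  (basis h).constr ℂ fun g => basis h g⁻¹

theorem comulLin_basis (v : Gp) (x : Gm) : comulLin h (basis h ((v : G) * x)) =
    ∑ u : Gp, basis h (((v * u⁻¹ : Gp) : G) * negLeft h u x) ⊗ₜ[ℂ] basis h ((u : G) * x) := by
  simp only [comulLin, Module.Basis.constr_basis, pos_coe_mul_coe, neg_coe_mul_coe]
  push_cast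
  rfl

open Classical in
theorem counitLin_basis (v : Gp) (x : Gm) :
    counitLin h (basis h ((v : G) * x)) = if v = 1 then 1 else 0 := by
  simp only [counitLin, Module.Basis.constr_basis, pos_coe_mul_coe]

theorem antipodeLin_basis (g : G) : antipodeLin h (basis h g) = basis h g⁻¹ := by
  simp only [antipodeLin, Module.Basis.constr_basis]

noncomputable instance : Coalgebra ℂ (Bicrossproduct h) where
  comul := comulLin h
  counit := counitLin h
  coassoc := by
    refine (basis h).ext fun g => ?_
    obtain ⟨v, x, rfl⟩ := exists_eq h g
    simp only [LinearMap.comp_apply, comulLin_basis, map_sum, LinearMap.rTensor_tmul,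
      LinearMap.lTensor_tmul, TensorProduct.sum_tmul, TensorProduct.tmul_sum,
      LinearEquiv.coe_coe, TensorProduct.assoc_tmul]
    rw [Finset.sum_comm]
    conv_rhs => rw [Finset.sum_comm]
    rw [Finset.sum_comm]
    refine Finset.sum_congr rfl fun u _ => ?_
    refine Fintype.sum_equiv (Equiv.mulRight u) _ _ fun w => ?_
    simp [(mul_act h _ _ _).1, mul_assoc]
  rTensor_counit_comp_comul := by
    classical
    refine (basis h).ext fun g => ?_
    obtain ⟨v, x, rfl⟩ := exists_eq h g
    simp only [LinearMap.comp_apply, comulLin_basis, map_sum, LinearMap.rTensor_tmul,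
      counitLin_basis, mul_inv_eq_one, TensorProduct.mk_apply]
    rw [Finset.sum_eq_single v] <;> simp +contextual [eq_comm]
  lTensor_counit_comp_comul := by
    classical
    refine (basis h).ext fun g => ?_
    obtain ⟨v, x, rfl⟩ := exists_eq h g
    simp only [LinearMap.comp_apply, comulLin_basis, map_sum, LinearMap.lTensor_tmul,
      counitLin_basis, LinearMap.flip_apply, TensorProduct.mk_apply]
    rw [Finset.sum_eq_single 1] <;> simp +contextual [(one_act h _).1]

theorem counit_def (a : Bicrossproduct h) : Coalgebra.counit (R := ℂ) a = counitLin h a := rfl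

theorem comul_def (a : Bicrossproduct h) : Coalgebra.comul (R := ℂ) a = comulLin h a := rfl

theorem counit_mul' (a b : Bicrossproduct h) :
    counitLin h (a * b) = counitLin h a * counitLin h b := by
  classical
  induction a using induct with
  | hadd a a' ha ha' => rw [add_mul, map_add, ha, ha', map_add, add_mul]
  | hsmul r a ha => rw [smul_mul', map_smul, ha, map_smul, smul_mul_assoc]
  | hof g =>
  induction b using induct with
  | hadd a a' ha ha' => rw [mul_add, map_add, ha, ha', map_add, mul_add]
  | hsmul r a ha => rw [mul_smul', map_smul, ha, map_smul, mul_smul_comm]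
  | hof k =>
    obtain ⟨u, x, rfl⟩ := exists_eq h g
    obtain ⟨v, y, rfl⟩ := exists_eq h k
    rw [basis_mul_basis', counitLin_basis, counitLin_basis, apply_ite (counitLin h),
      counitLin_basis, map_zero]
    by_cases hu : u = 1
    · subst hu; simp [(one_act h _).2, eq_comm]
    · simp [hu]

theorem comul_mul' (a b : Bicrossproduct h) :
    comulLin h (a * b) = comulLin h a * comulLin h b := by
  classical
  induction a using induct with
  | hadd a a' ha ha' => rw [add_mul, map_add, ha, ha', map_add, add_mul]
  | hsmul r a ha => rw [smul_mul', map_smul, ha, map_smul, smul_mul_assoc]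
  | hof g =>
  induction b using induct with
  | hadd a a' ha ha' => rw [mul_add, map_add, ha, ha', map_add, mul_add]
  | hsmul r a ha => rw [mul_smul', map_smul, ha, map_smul, mul_smul_comm]
  | hof k =>
    obtain ⟨u, x, rfl⟩ := exists_eq h g
    obtain ⟨v, y, rfl⟩ := exists_eq h k
    rw [basis_mul_basis', comulLin_basis, comulLin_basis, apply_ite (comulLin h),
      comulLin_basis, map_zero, Finset.sum_mul_sum]
    simp only [Algebra.TensorProduct.tmul_mul_tmul, basis_mul_basis']
    have key : ∀ w : Gp, posRight h (u * w⁻¹) (negLeft h w x) = v * (posRight h w x)⁻¹ ↔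
        posRight h u x = v := fun w => by
      have := (mul_act h (u * w⁻¹) w x).2
      rw [inv_mul_cancel_right] at this
      rw [this, eq_mul_inv_iff_mul_eq]
    by_cases huv : posRight h u x = v
    · rw [if_pos huv]
      refine Finset.sum_congr rfl fun w _ => ?_
      rw [Finset.sum_eq_single (posRight h w x)]
      · rw [if_pos ((key w).2 huv), if_pos rfl, (act_mul h w x y).1]
      · intro z _ hz
        rw [if_neg (Ne.symm hz), TensorProduct.tmul_zero]
      · simp
    · rw [if_neg huv]
      symm
      refine Finset.sum_eq_zero fun w _ => Finset.sum_eq_zero fun z _ => ?_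
      by_cases hz : posRight h w x = z
      · subst hz
        rw [if_neg (fun hh => huv ((key w).1 hh)), TensorProduct.zero_tmul]
      · rw [if_neg hz, TensorProduct.tmul_zero]

theorem counit_one' : counitLin h 1 = 1 := by
  classical
  have : ∀ u : Gp, counitLin h (basis h (u : G)) = if u = 1 then 1 else 0 := fun u => by
    simpa using counitLin_basis h u 1
  simp [one_def, this]

theorem comul_one' : comulLin h 1 = 1 := by
  have : ∀ v : Gp, comulLin h (basis h (v : G)) =
      ∑ u : Gp, basis h ((v * u⁻¹ : Gp) : G) ⊗ₜ[ℂ] basis h (u : G) := fun v => by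
    simpa [(act_one h _).1] using comulLin_basis h v 1
  simp only [Algebra.TensorProduct.one_def, one_def, map_sum, this, TensorProduct.sum_tmul,
    TensorProduct.tmul_sum]
  rw [Finset.sum_comm]
  refine Finset.sum_congr rfl fun u _ => ?_
  exact Fintype.sum_equiv (Equiv.mulRight u⁻¹) _ _ fun w => by simp

noncomputable instance : Bialgebra ℂ (Bicrossproduct h) :=
  Bialgebra.mk' ℂ (Bicrossproduct h) (counit_one' h) (counit_mul' h _ _) (comul_one' h)
    (comul_mul' h _ _)

theorem antipodeLin_basis' (v : Gp) (x : Gm) : antipodeLin h (basis h ((v : G) * x)) =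
    basis h ((((posRight h v x)⁻¹ : Gp) : G) * ((negLeft h v x)⁻¹ : Gm)) := by
  rw [antipodeLin_basis, ← negLeft_mul_posRight h v x]
  simp

/-- The bicrossproduct Hopf algebra `H(G; Gp, Gm)`. -/
noncomputable instance : HopfAlgebra ℂ (Bicrossproduct h) where
  antipode := antipodeLin h
  mul_antipode_rTensor_comul := by
    refine (basis h).ext fun g => ?_
    obtain ⟨v, x, rfl⟩ := exists_eq h g
    simp only [LinearMap.comp_apply, comul_def, counit_def, comulLin_basis, map_sum,
      LinearMap.rTensor_tmul, counitLin_basis, LinearMap.mul'_apply, antipodeLin_basis',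
      basis_mul_basis', Algebra.linearMap_apply]
    by_cases hv : v = 1
    · subst hv
      simp only [one_mul, if_true, map_one]
      rw [one_def, ← (posRight_bijective h x).sum_comp (fun u : Gp => basis h (u : G))]
      refine Finset.sum_congr rfl fun u _ => ?_
      rw [if_pos (by rw [inv_act, one_mul, inv_inv])]
      have h1 := mul_act h u⁻¹ u x
      rw [inv_mul_cancel, (one_act h x).1, (one_act h x).2] at h1
      rw [← h1.1, inv_eq_of_mul_eq_one_right h1.2.symm]
      simp
    · rw [if_neg hv, map_zero]
      refine Finset.sum_eq_zero fun u _ => if_neg ?_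
      simpa [inv_act] using hv
  mul_antipode_lTensor_comul := by
    refine (basis h).ext fun g => ?_
    obtain ⟨v, x, rfl⟩ := exists_eq h g
    have key : ∀ u : Gp, posRight h (v * u⁻¹) (negLeft h u x) = (posRight h u x)⁻¹ ↔ v = 1 :=
      fun u => by
        have := (mul_act h (v * u⁻¹) u x).2
        rw [inv_mul_cancel_right] at this
        rw [eq_inv_iff_mul_eq_one, ← this, posRight_eq_one]
    simp only [LinearMap.comp_apply, comul_def, counit_def, comulLin_basis, map_sum,
      LinearMap.lTensor_tmul, counitLin_basis, LinearMap.mul'_apply, antipodeLin_basis',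
      basis_mul_basis', Algebra.linearMap_apply]
    by_cases hv : v = 1
    · subst hv
      simp only [if_true, map_one, mul_inv_cancel, one_def]
      refine Fintype.sum_equiv (Equiv.inv Gp) _ _ fun u => ?_
      rw [if_pos ((key u).2 rfl)]
      simp
    · rw [if_neg hv, map_zero]
      exact Finset.sum_eq_zero fun u _ => if_neg fun hu => hv ((key u).1 hu)

/-- `R` has non-negative real coefficients in the basis `{g} ⊗ {k}` of `H ⊗ H`. -/
def IsPositive (R : Bicrossproduct h ⊗[ℂ] Bicrossproduct h) : Prop :=
  ∀ g k : G, ∃ r : ℝ, 0 ≤ r ∧ ((basis h).tensorProduct (basis h)).repr R (g, k) = (r : ℂ)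

/-- `∑ {u (η(v) ^ u)⁻¹} ⊗ {v ξ(u)}` over `u, v ∈ Gp`. -/
noncomputable def rMatrix (ξ η : Gp →* Gm) : Bicrossproduct h ⊗[ℂ] Bicrossproduct h :=
  ∑ u : Gp, ∑ v : Gp,
    basis h ((u : G) * ((negRight h (η v) u)⁻¹ : Gm)) ⊗ₜ[ℂ] basis h ((v : G) * ξ u)

end Hopf

end Bicrossproduct

/-- `R ∈ H ⊗ H` is a quasi-triangular structure on the Hopf algebra `H`: it is invertible,
`τ Δ(a) = R Δ(a) R⁻¹`, `(Δ ⊗ id) R = R₁₃ R₂₃`, `(id ⊗ Δ) R = R₁₃ R₁₂` in `H ⊗ (H ⊗ H)`, and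
`(ε ⊗ id) R = 1 = (id ⊗ ε) R`. -/
structure IsQuasiTriangular {k H : Type*} [CommRing k] [Ring H] [HopfAlgebra k H]
    (R : H ⊗[k] H) : Prop where
  conj : ∃ U : (H ⊗[k] H)ˣ, (U : H ⊗[k] H) = R ∧ ∀ a : H,
    TensorProduct.comm k H H (Coalgebra.comul (R := k) a) =
      (U : H ⊗[k] H) * Coalgebra.comul (R := k) a * ((U⁻¹ : (H ⊗[k] H)ˣ) : H ⊗[k] H)
  comul_left :
    TensorProduct.assoc k H H H ((Coalgebra.comul (R := k) (A := H)).rTensor H R) =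
      Algebra.TensorProduct.map (AlgHom.id k H) Algebra.TensorProduct.includeRight R *
        (Algebra.TensorProduct.includeRight : H ⊗[k] H →ₐ[k] H ⊗[k] (H ⊗[k] H)) R
  comul_right :
    (Coalgebra.comul (R := k) (A := H)).lTensor H R =
      Algebra.TensorProduct.map (AlgHom.id k H) Algebra.TensorProduct.includeRight R *
        Algebra.TensorProduct.map (AlgHom.id k H) Algebra.TensorProduct.includeLeft R
  counit_left : TensorProduct.lid k H ((Coalgebra.counit (R := k) (A := H)).rTensor H R) = 1
  counit_right : TensorProduct.rid k H ((Coalgebra.counit (R := k) (A := H)).lTensor H R) = 1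

/-- The sets `G₊' = {u ξ(u⁻¹)}` and `G₊'' = {η(u⁻¹) u}` are normal subgroups `N'` and `N''` of `G`,
and `u ξ(u⁻¹) ↦ η(u) u⁻¹` is a group isomorphism `G₊' → G₊''`. -/
def IsRDatum {G : Type*} [Group G] {Gp Gm : Subgroup G} (ξ η : Gp →* Gm) : Prop :=
  ∃ N' N'' : Subgroup G,
    (N' : Set G) = {g | ∃ u : Gp, g = (u : G) * ξ u⁻¹} ∧
    (N'' : Set G) = {g | ∃ u : Gp, g = (η u⁻¹ : G) * u} ∧
    N'.Normal ∧ N''.Normal ∧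
    ∃ F : N' ≃* N'', ∀ (u : Gp) (hu : (u : G) * ξ u⁻¹ ∈ N'),
      (F ⟨(u : G) * ξ u⁻¹, hu⟩ : G) = (η u : G) * (u : G)⁻¹

/-
`H` is the algebra of the action groupoid of `Gm` acting on `Gp` from the right: `{u x}` is an arrow
from `u` to `u ^ x`. In a groupoid algebra, an invertible element such that it and its inverse have
non-negative coefficients has exactly one arrow out of every object. The inverse of a
quasi-triangular structure `R` is `(S ⊗ id) R`, whose coefficients are those of `R` permuted; so a
positive `R` is of the form `∑ c(u, v) {u A(u, v)} ⊗ {v B(u, v)}` with `c > 0`. For such an `R` the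
axioms become pointwise identities, which say that `c` is multiplicative, hence `1` because `Gp` is
finite, and that `B(u, v) = ξ(u)` and `A(u, v) = η(v ^ ξ(u))⁻¹` for two homomorphisms `ξ`, `η`.

The remaining identities for `ξ` and `η` mean that `x u ↦ x ξ(u)` and `x u ↦ x η(u)` are
homomorphisms `G → Gm`, with kernels `G₊'` and `G₊''`, and that `F` is multiplicative.
-/

section Monomial

variable {k S X M : Type*} [CommSemiring k] [AddCommMonoid S] [Module k S] [Fintype X]

/-- The element `∑ u, c u • b (u, A u)`, supported on the graph of `A : X → M`. -/
noncomputable def graphSum (b : Module.Basis (X × M) k S) (c : X → k) (A : X → M) : S :=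
  ∑ u, c u • b (u, A u)

open Classical in
theorem repr_graphSum (b : Module.Basis (X × M) k S) (c : X → k) (A : X → M) (u : X) (x : M) :
    b.repr (graphSum b c A) (u, x) = if A u = x then c u else 0 := by
  simp only [graphSum, map_sum, map_smul, Module.Basis.repr_self, Finsupp.coe_finsetSum,
    Finset.sum_apply, Finsupp.smul_single, smul_eq_mul, mul_one, Finsupp.single_apply,
    Prod.mk.injEq, ite_and, Finset.sum_ite_eq', Finset.mem_univ, if_true]

theorem graphSum_eq_graphSum_iff (b : Module.Basis (X × M) k S) {c c' : X → k} {A A' : X → M} :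
    graphSum b c A = graphSum b c' A' ↔ ∀ u, c u = c' u ∧ (c u ≠ 0 → A u = A' u) := by
  classical
  constructor
  · intro e u
    have coeff (x : M) : (if A u = x then c u else 0) = if A' u = x then c' u else 0 := by
      rw [← repr_graphSum b, ← repr_graphSum b, e]
    have hc := coeff (A u)
    have hc' := coeff (A' u)
    by_cases hA : A u = A' u <;> simp_all
  · refine fun e => Finset.sum_congr rfl fun u _ => ?_
    obtain ⟨hc, hA⟩ := e u
    by_cases h0 : c u = 0
    · rw [← hc, h0, zero_smul, zero_smul]
    · rw [← hc, hA h0]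

theorem graphSum_eq_graphSum_iff_of_ne_zero (b : Module.Basis (X × M) k S) {c c' : X → k}
    {A A' : X → M} (hc : ∀ u, c u ≠ 0) :
    graphSum b c A = graphSum b c' A' ↔ ∀ u, c u = c' u ∧ A u = A' u := by
  simp only [graphSum_eq_graphSum_iff, ne_eq, hc, not_false_eq_true, forall_const]

end Monomial

section TensorBasis

variable {k S T X Y M N : Type*} [CommSemiring k] [AddCommMonoid S] [AddCommMonoid T] [Module k S]
  [Module k T]

/-- The basis `b (u, x) ⊗ b' (v, y)`, indexed by `((u, v), (x, y))`. -/
noncomputable def tensorBasis (b : Module.Basis (X × M) k S) (b' : Module.Basis (Y × N) k T) :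
    Module.Basis ((X × Y) × (M × N)) k (S ⊗[k] T) :=
  (b.tensorProduct b').reindex (Equiv.prodProdProdComm X M Y N)

theorem tensorBasis_apply (b : Module.Basis (X × M) k S) (b' : Module.Basis (Y × N) k T)
    (p : (X × Y) × (M × N)) :
    tensorBasis b b' p = b (p.1.1, p.2.1) ⊗ₜ[k] b' (p.1.2, p.2.2) := by
  simp [tensorBasis]

end TensorBasis

section ActionBasis

variable {k S T X Y M N : Type*} [Group M] [Group N] [Fintype X] [Fintype Y]

open Classical in
/-- The basis vectors `b (u, x)` multiply like the arrows `x : u ⟶ act u x` of the action groupoid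
of a right action `act` of `M` on `X`. The action is a bare function, since the one needed below
depends on the factorization of the ambient group. -/
structure IsActionBasis [CommSemiring k] [Semiring S] [Algebra k S] (act : X → M → X)
    (b : Module.Basis (X × M) k S) : Prop where
  act_one : ∀ u, act u 1 = u
  act_mul : ∀ u x y, act u (x * y) = act (act u x) y
  mul_eq : ∀ u x v y, b (u, x) * b (v, y) = if act u x = v then b (u, x * y) else 0
  one_eq : 1 = graphSum b 1 1

namespace IsActionBasis

section CommSemiring

variable [CommSemiring k] [Semiring S] [Algebra k S] [Semiring T] [Algebra k T]
  {act : X → M → X} {b : Module.Basis (X × M) k S} {act' : Y → N → Y}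
  {b' : Module.Basis (Y × N) k T}

theorem act_act_inv (hb : IsActionBasis act b) (u : X) (x : M) : act (act u x) x⁻¹ = u := by
  rw [← hb.act_mul, mul_inv_cancel, hb.act_one]

theorem graphSum_mul_graphSum (hb : IsActionBasis act b) (c c' : X → k) (A A' : X → M) :
    graphSum b c A * graphSum b c' A' =
      graphSum b (fun u => c u * c' (act u (A u))) fun u => A u * A' (act u (A u)) := by
  classical
  simp only [graphSum, Finset.sum_mul, Finset.mul_sum, smul_mul_smul_comm, hb.mul_eq, smul_ite,
    smul_zero]
  rw [Finset.sum_comm]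
  simp only [Finset.sum_ite_eq, Finset.mem_univ, if_true]

theorem tensor (hb : IsActionBasis act b) (hb' : IsActionBasis act' b') :
    IsActionBasis (fun (p : X × Y) (q : M × N) => (act p.1 q.1, act' p.2 q.2))
      (tensorBasis b b') where
  act_one p := by simp only [Prod.fst_one, Prod.snd_one, hb.act_one, hb'.act_one]
  act_mul p x y := by simp only [Prod.fst_mul, Prod.snd_mul, hb.act_mul, hb'.act_mul]
  mul_eq p x q y := by
    simp only [tensorBasis_apply, Algebra.TensorProduct.tmul_mul_tmul, hb.mul_eq, hb'.mul_eq,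
      TensorProduct.ite_tmul, TensorProduct.tmul_ite, Prod.fst_mul, Prod.snd_mul]
    split_ifs <;> simp_all [Prod.ext_iff]
  one_eq := by
    simp only [Algebra.TensorProduct.one_def, hb.one_eq, hb'.one_eq, graphSum,
      TensorProduct.sum_tmul, TensorProduct.tmul_sum, Fintype.sum_prod_type, tensorBasis_apply,
      Pi.one_apply, one_smul, Prod.fst_one, Prod.snd_one]
    exact Finset.sum_comm

theorem repr_mul [Fintype M] (hb : IsActionBasis act b) (a a' : S) (u : X) (z : M) :
    b.repr (a * a') (u, z) = ∑ x, b.repr a (u, x) * b.repr a' (act u x, x⁻¹ * z) := by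
  classical
  have hcoeff (p q : X × M) : b.repr (b p * b q) (u, z) =
      if p.1 = u then if q = (act u p.2, p.2⁻¹ * z) then 1 else 0 else 0 := by
    rw [hb.mul_eq]
    obtain ⟨v, x⟩ := p
    obtain ⟨w, y⟩ := q
    simp only [Prod.mk.injEq, eq_inv_mul_iff_mul_eq]
    split_ifs <;> simp_all
  conv_lhs => rw [← b.sum_repr a, ← b.sum_repr a']
  simp only [Finset.sum_mul, Finset.mul_sum, smul_mul_smul_comm, map_sum, map_smul,
    Finsupp.coe_finsetSum, Finset.sum_apply, Finsupp.smul_apply, smul_eq_mul, hcoeff, mul_ite,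
    mul_one, mul_zero]
  rw [Finset.sum_comm]
  simp [Fintype.sum_prod_type]

end CommSemiring

theorem exists_eq_graphSum [Finite M] [CommRing k] [PartialOrder k] [IsOrderedRing k]
    [NoZeroDivisors k] [Nontrivial k] [Ring S] [Algebra k S] {act : X → M → X}
    {b : Module.Basis (X × M) k S} (hb : IsActionBasis act b) {a a' : S}
    (ha : ∀ p, 0 ≤ b.repr a p) (ha' : ∀ p, 0 ≤ b.repr a' p) (h : a * a' = 1) (h' : a' * a = 1) :
    ∃ (c : X → k) (A : X → M), (∀ u, 0 < c u) ∧ a = graphSum b c A := by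
  classical
  have := Fintype.ofFinite M
  have repr_one (u : X) (z : M) : b.repr 1 (u, z) = if 1 = z then 1 else 0 := by
    rw [hb.one_eq, repr_graphSum]; rfl
  have exists_arrow (u : X) : ∃ x, b.repr a (u, x) ≠ 0 ∧ b.repr a' (act u x, x⁻¹) ≠ 0 := by
    have hsum : ∑ x, b.repr a (u, x) * b.repr a' (act u x, x⁻¹ * 1) ≠ 0 := by
      rw [← hb.repr_mul, h, repr_one, if_pos rfl]
      exact one_ne_zero
    obtain ⟨x, -, hx⟩ := Finset.exists_ne_zero_of_sum_ne_zero hsum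
    rw [mul_one] at hx
    exact ⟨x, mul_ne_zero_iff.1 hx⟩
  choose A hA hA' using exists_arrow
  have eq_of_ne_zero (u : X) (x : M) (hx : b.repr a (u, x) ≠ 0) : A u = x := by
    by_contra hne
    have hsum := hb.repr_mul a' a (act u (A u)) ((A u)⁻¹ * x)
    rw [h', repr_one, if_neg (by rwa [eq_comm, inv_mul_eq_one])] at hsum
    have hterm := (Finset.sum_eq_zero_iff_of_nonneg fun y _ => mul_nonneg (ha' _) (ha _)).1
      hsum.symm (A u)⁻¹ (Finset.mem_univ _)
    rw [hb.act_act_inv, inv_inv, mul_inv_cancel_left] at hterm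
    exact mul_ne_zero (hA' u) hx hterm
  refine ⟨fun u => b.repr a (u, A u), A, fun u => (ha _).lt_of_ne' (hA u), b.ext_elem ?_⟩
  rintro ⟨u, x⟩
  rw [repr_graphSum]
  split_ifs with hx
  · rw [hx]
  · exact not_ne_iff.1 (mt (eq_of_ne_zero u x) hx)

end IsActionBasis

end ActionBasis

namespace UniqueFactorization

section Retraction

variable {G : Type*} [Group G] {Gp Gm : Subgroup G} {h : Gp.IsComplement' Gm} {ξ η : Gp →* Gm}

theorem neg_mul_pos_mul_neg_mul_pos (h : Gp.IsComplement' Gm) (x y : Gm) (u v : Gp) :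
    ((x : G) * u) * ((y : G) * v) =
      ((x * negLeft h u y : Gm) : G) * ((posRight h u y * v : Gp) : G) := by
  rw [mul_assoc, ← mul_assoc (u : G), ← negLeft_mul_posRight h u y]
  simp only [Subgroup.coe_mul, mul_assoc]

theorem negRight_inv (h : Gp.IsComplement' Gm) (x : Gm) (u : Gp) :
    (negRight h x u)⁻¹ = negLeft h u⁻¹ x⁻¹ := by
  simp only [negLeft, negBar, negRight, Subgroup.coe_inv, mul_inv_rev, inv_inv]

variable (h ξ) in
/-- The identity under which `ξ` and the identity of `Gm` extend to a homomorphism `G →* Gm`, that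
is, under which `x u ↦ x ξ(u)` is multiplicative. -/
def ExtendsToRetraction : Prop :=
  ∀ u x, ξ u * x = negLeft h u x * ξ (posRight h u x)

/-- The element `ξ(u)⁻¹ u` of `G`. -/
def twist (ξ : Gp →* Gm) (u : Gp) : G := (ξ u : G)⁻¹ * u

theorem twist_injective (h : Gp.IsComplement' Gm) (ξ : Gp →* Gm) :
    Function.Injective (twist ξ) := fun u v e =>
  (eq_of_mul_eq' h (x := (ξ u)⁻¹) (y := (ξ v)⁻¹) (by simpa [twist] using e)).1

theorem coe_mul_map_inv (ξ : Gp →* Gm) (u : Gp) : (u : G) * ξ u⁻¹ = (twist ξ u⁻¹)⁻¹ := by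
  simp [twist]

theorem coe_eq_setOf_coe_mul_map_inv_iff {N : Subgroup G} :
    (N : Set G) = {g | ∃ u : Gp, g = (u : G) * ξ u⁻¹} ↔ ∀ g, g ∈ N ↔ ∃ u, g = twist ξ u := by
  rw [Set.ext_iff, ← (Equiv.inv G).forall_congr_right]
  refine forall_congr' fun g => ?_
  rw [← (Equiv.inv Gp).exists_congr_right]
  simp only [Equiv.inv_apply, coe_mul_map_inv, SetLike.mem_coe, inv_mem_iff, Set.mem_ofPred_eq,
    inv_inj]

theorem coe_eq_setOf_map_inv_mul_coe_iff {N : Subgroup G} :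
    (N : Set G) = {g | ∃ u : Gp, g = (ξ u⁻¹ : G) * u} ↔ ∀ g, g ∈ N ↔ ∃ u, g = twist ξ u := by
  simp only [Set.ext_iff, SetLike.mem_coe, Set.mem_ofPred_eq, map_inv, Subgroup.coe_inv, twist]

theorem extendsToRetraction_of_normal (h : Gp.IsComplement' Gm) {N : Subgroup G} [N.Normal]
    (hN : ∀ g, g ∈ N ↔ ∃ u, g = twist ξ u) : ExtendsToRetraction h ξ := by
  have mk_coe (u : Gp) : ((u : G) : G ⧸ N) = (ξ u : G) :=
    (QuotientGroup.eq.2 ((hN _).2 ⟨u, rfl⟩)).symm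
  have eq_of_mk_eq {x y : Gm} (e : ((x : G) : G ⧸ N) = (y : G)) : x = y := by
    obtain ⟨u, hu⟩ := (hN _).1 (QuotientGroup.eq.1 e)
    have hu' := eq_of_mul_eq' h (x := x⁻¹ * y) (u := 1) (y := (ξ u)⁻¹) (by simpa [twist] using hu)
    rw [← hu'.1, map_one, inv_one, inv_mul_eq_one] at hu'
    exact hu'.2
  intro u x
  apply eq_of_mk_eq
  rw [Subgroup.coe_mul, Subgroup.coe_mul, QuotientGroup.mk_mul, QuotientGroup.mk_mul, ← mk_coe,
    ← mk_coe, ← QuotientGroup.mk_mul, ← QuotientGroup.mk_mul, negLeft_mul_posRight]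

namespace ExtendsToRetraction

/-- The homomorphism `x u ↦ x ξ(u)` from `G` to `Gm`. -/
noncomputable def retraction (hξ : ExtendsToRetraction h ξ) : G →* Gm :=
  MonoidHom.mk' (fun g => negBar h g * ξ (posBar h g)) fun g k => by
    conv_lhs => rw [← negBar_mul_posBar h g, ← negBar_mul_posBar h k]
    rw [neg_mul_pos_mul_neg_mul_pos h, negBar_coe_mul_coe, posBar_coe_mul_coe, map_mul, mul_assoc,
      ← mul_assoc (negLeft h _ _), ← hξ, mul_assoc, mul_assoc]

theorem retraction_coe_mul_coe (hξ : ExtendsToRetraction h ξ) (x : Gm) (u : Gp) :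
    hξ.retraction (x * u) = x * ξ u := by
  simp [retraction]

theorem mem_ker_retraction (hξ : ExtendsToRetraction h ξ) {g : G} :
    g ∈ hξ.retraction.ker ↔ ∃ u, g = twist ξ u := by
  constructor
  · intro hg
    refine ⟨posBar h g, ?_⟩
    rw [MonoidHom.mem_ker, ← negBar_mul_posBar h g, retraction_coe_mul_coe] at hg
    conv_lhs => rw [← negBar_mul_posBar h g, eq_inv_of_mul_eq_one_left hg]
    rfl
  · rintro ⟨u, rfl⟩
    rw [MonoidHom.mem_ker, twist, ← Subgroup.coe_inv, retraction_coe_mul_coe, inv_mul_cancel]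

theorem twist_mul_twist (hξ : ExtendsToRetraction h ξ) (u v : Gp) :
    twist ξ u * twist ξ v = twist ξ (posRight h u (ξ v)⁻¹ * v) := by
  have mem (u : Gp) : twist ξ u ∈ hξ.retraction.ker := hξ.mem_ker_retraction.2 ⟨u, rfl⟩
  obtain ⟨w, hw⟩ := hξ.mem_ker_retraction.1 (mul_mem (mem u) (mem v))
  have e := neg_mul_pos_mul_neg_mul_pos h (ξ u)⁻¹ (ξ v)⁻¹ u v
  simp only [Subgroup.coe_inv] at e
  have e' := eq_of_mul_eq' h (y := (ξ w)⁻¹) (e.symm.trans hw)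
  rw [hw, e'.1]

/-- The bijection from `Gp` onto the kernel of the retraction given by `u ↦ ξ(u)⁻¹ u`. -/
noncomputable def twistEquiv (hξ : ExtendsToRetraction h ξ) : Gp ≃ hξ.retraction.ker :=
  Equiv.ofBijective (fun u => ⟨twist ξ u, hξ.mem_ker_retraction.2 ⟨u, rfl⟩⟩)
    ⟨fun _ _ e => twist_injective h ξ (congrArg Subtype.val e), fun g =>
      (hξ.mem_ker_retraction.1 g.2).imp fun _ hu => Subtype.ext hu.symm⟩

theorem twistEquiv_mul_twistEquiv (hξ : ExtendsToRetraction h ξ) (u v : Gp) :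
    hξ.twistEquiv u * hξ.twistEquiv v = hξ.twistEquiv (posRight h u (ξ v)⁻¹ * v) :=
  Subtype.ext (hξ.twist_mul_twist u v)

end ExtendsToRetraction

variable (h ξ η) in
/-- The conditions (a) and (b) on `ξ` and `η` in terms of the actions of `Gp` and `Gm` on each
other: (a) amounts to `left` and `right`, and (b) to `cross`. -/
structure IsCompatible : Prop where
  left : ExtendsToRetraction h ξ
  right : ExtendsToRetraction h η
  cross : ∀ u v : Gp, posRight h u (η v)⁻¹ * v = posRight h v (ξ u)⁻¹ * u

theorem isCompatible_of_isRDatum (h : Gp.IsComplement' Gm) (H : IsRDatum ξ η) :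
    IsCompatible h ξ η := by
  obtain ⟨N', N'', h', h'', _, _, F, hF⟩ := H
  have mem' := coe_eq_setOf_coe_mul_map_inv_iff.1 h'
  have left : ExtendsToRetraction h ξ := extendsToRetraction_of_normal h mem'
  have right : ExtendsToRetraction h η :=
    extendsToRetraction_of_normal h (coe_eq_setOf_map_inv_mul_coe_iff.1 h'')
  refine ⟨left, right, fun u v => twist_injective h η ?_⟩
  let θ (u : Gp) : N' := ⟨twist ξ u, (mem' _).2 ⟨u, rfl⟩⟩
  have map_inv_twist (u : Gp) : (F (θ u)⁻¹ : G) = twist η u := by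
    have e : ((u⁻¹ : Gp) : G) * ξ u⁻¹⁻¹ = ((θ u)⁻¹ : N') := by
      rw [coe_mul_map_inv, inv_inv, Subgroup.coe_inv]
    have e' : ⟨_, e ▸ (θ u)⁻¹.2⟩ = (θ u)⁻¹ := Subtype.ext e
    rw [← e', hF, map_inv, twist, Subgroup.coe_inv, Subgroup.coe_inv, inv_inv]
  have mul_twist : θ v * θ u = θ (posRight h v (ξ u)⁻¹ * u) :=
    Subtype.ext (left.twist_mul_twist v u)
  rw [← right.twist_mul_twist, ← map_inv_twist, ← map_inv_twist, ← map_inv_twist, ← mul_twist,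
    mul_inv_rev, map_mul, Subgroup.coe_mul]

theorem IsCompatible.isRDatum (H : IsCompatible h ξ η) : IsRDatum ξ η := by
  refine ⟨H.left.retraction.ker, H.right.retraction.ker,
    coe_eq_setOf_coe_mul_map_inv_iff.2 fun _ => H.left.mem_ker_retraction,
    coe_eq_setOf_map_inv_mul_coe_iff.2 fun _ => H.right.mem_ker_retraction,
    inferInstance, inferInstance,
    MulEquiv.mk' ((Equiv.inv _).trans (H.left.twistEquiv.symm.trans H.right.twistEquiv)) ?_, ?_⟩
  · intro m n
    obtain ⟨u, hu⟩ := H.left.twistEquiv.surjective m⁻¹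
    obtain ⟨v, hv⟩ := H.left.twistEquiv.surjective n⁻¹
    simp [← hu, ← hv, ExtendsToRetraction.twistEquiv_mul_twistEquiv, H.cross]
  · intro u hu
    have e : (⟨(u : G) * ξ u⁻¹, hu⟩ : H.left.retraction.ker)⁻¹ = H.left.twistEquiv u⁻¹ :=
      Subtype.ext (inv_eq_iff_eq_inv.2 (coe_mul_map_inv ξ u))
    change (H.right.twistEquiv (H.left.twistEquiv.symm
      (⟨(u : G) * ξ u⁻¹, hu⟩ : H.left.retraction.ker)⁻¹) : G) = _
    rw [e, Equiv.symm_apply_apply]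
    simp [ExtendsToRetraction.twistEquiv, twist]

namespace IsCompatible

theorem posRight_mul_posRight (H : IsCompatible h ξ η) (u v : Gp) :
    posRight h u (η (posRight h v (ξ u)))⁻¹ * posRight h v (ξ u) = v * u := by
  rw [H.cross, ← (act_mul h _ _ _).2, mul_inv_cancel, (act_one h _).2]

theorem negLeft_inv_map (H : IsCompatible h ξ η) (u v : Gp) :
    negLeft h u (η (posRight h v (ξ u)))⁻¹ = (η v)⁻¹ := by
  have e := congrArg η (H.posRight_mul_posRight u v)
  rw [map_mul, map_mul, ← eq_mul_inv_iff_mul_eq] at e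
  have e' := H.right u (η (posRight h v (ξ u)))⁻¹
  rwa [e, ← mul_assoc, mul_left_inj, ← mul_assoc, right_eq_mul, mul_eq_one_iff_eq_inv] at e'

theorem negLeft_map (H : IsCompatible h ξ η) (u v : Gp) :
    negLeft h v (ξ u) = ξ (posRight h u (η (posRight h v (ξ u)))⁻¹) := by
  refine mul_right_cancel (b := ξ (posRight h v (ξ u))) ?_
  rw [← H.left, ← map_mul, ← map_mul, H.posRight_mul_posRight]

theorem negRight_map_inv (H : IsCompatible h ξ η) (u v : Gp) :
    (negRight h (η v) u)⁻¹ = (η (posRight h v (ξ u)))⁻¹ := by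
  rw [negRight_inv, ← H.negLeft_inv_map u v, ← (mul_act h _ _ _).1, inv_mul_cancel, (one_act h _).1]

end IsCompatible

end Retraction

end UniqueFactorization

open scoped ComplexOrder

theorem eq_one_of_pos_of_pow_eq_one {𝕜 : Type*} [RCLike 𝕜] {z : 𝕜} {n : ℕ} (hz : 0 < z)
    (hn : n ≠ 0) (e : z ^ n = 1) : z = 1 := by
  obtain ⟨r, hr, rfl⟩ := RCLike.pos_iff_exists_ofReal.1 hz
  exact_mod_cast (pow_eq_one_iff_of_nonneg hr.le hn).1 (by exact_mod_cast e)

theorem antipode_rTensor_mul_self {k H : Type*} [CommRing k] [Ring H] [HopfAlgebra k H]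
    {R : H ⊗[k] H}
    (hΔ : TensorProduct.assoc k H H H ((Coalgebra.comul (R := k) (A := H)).rTensor H R) =
      Algebra.TensorProduct.map (AlgHom.id k H) Algebra.TensorProduct.includeRight R *
        (Algebra.TensorProduct.includeRight : H ⊗[k] H →ₐ[k] H ⊗[k] (H ⊗[k] H)) R)
    (hε : TensorProduct.lid k H ((Coalgebra.counit (R := k) (A := H)).rTensor H R) = 1) :
    (HopfAlgebra.antipode k (A := H)).rTensor H R * R = 1 := by
  let μS : H ⊗[k] (H ⊗[k] H) →ₗ[k] H ⊗[k] H :=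
    ((LinearMap.mul' k H ∘ₗ (HopfAlgebra.antipode k (A := H)).rTensor H).rTensor H) ∘ₗ
      (TensorProduct.assoc k H H H).symm.toLinearMap
  have μS_mul (T T' : H ⊗[k] H) :
      μS (Algebra.TensorProduct.map (AlgHom.id k H) Algebra.TensorProduct.includeRight T *
        (Algebra.TensorProduct.includeRight : H ⊗[k] H →ₐ[k] H ⊗[k] (H ⊗[k] H)) T') =
      (HopfAlgebra.antipode k (A := H)).rTensor H T * T' := by
    induction T with
    | zero => simp
    | add x y hx hy => simp only [map_add, add_mul, hx, hy]
    | tmul a b =>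
      induction T' with
      | zero => simp
      | add x y hx hy => simp only [map_add, mul_add, hx, hy]
      | tmul c d => simp [μS]
  have μS_comul (T : H ⊗[k] H) :
      μS (TensorProduct.assoc k H H H ((Coalgebra.comul (R := k) (A := H)).rTensor H T)) =
      1 ⊗ₜ TensorProduct.lid k H ((Coalgebra.counit (R := k) (A := H)).rTensor H T) := by
    induction T with
    | zero => simp
    | add x y hx hy => simp only [map_add, hx, hy, TensorProduct.tmul_add]
    | tmul a b =>
      have := HopfAlgebra.mul_antipode_rTensor_comul_apply (R := k) a
      simp [μS, this, Algebra.algebraMap_eq_smul_one, TensorProduct.smul_tmul]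
  rw [← μS_mul, ← hΔ, μS_comul, hε, Algebra.TensorProduct.one_def]

theorem sum_sum_mul_right {Γ S : Type*} [Group Γ] [Fintype Γ] [AddCommMonoid S] (f : Γ → Γ → S) :
    ∑ u, ∑ w, f (u * w) w = ∑ t, ∑ w, f t w := by
  rw [Finset.sum_comm, Finset.sum_comm (f := f)]
  exact Finset.sum_congr rfl fun w _ => Equiv.sum_comp (Equiv.mulRight w) fun t => f t w

namespace Bicrossproduct

open UniqueFactorization

noncomputable local instance {G : Type*} [Group G] [Finite G] (K : Subgroup G) : Fintype K :=
  Fintype.ofFinite K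

section ArrowBasis

variable {G : Type*} [Group G] {Gp Gm : Subgroup G} (h : Gp.IsComplement' Gm)

/-- The basis `{u x}` of `H(G; Gp, Gm)`, indexed by `(u, x)`. -/
noncomputable def arrowBasis : Module.Basis (Gp × Gm) ℂ (Bicrossproduct h) :=
  (basis h).reindex (Subgroup.IsComplement.equiv h)

theorem arrowBasis_apply (u : Gp) (x : Gm) : arrowBasis h (u, x) = basis h ((u : G) * x) := by
  simp only [arrowBasis, Module.Basis.reindex_apply]
  rfl

/-- The basis `{u x} ⊗ {v y}` of `H ⊗ H`, indexed by `((u, v), (x, y))`. -/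
noncomputable abbrev arrowBasis₂ : Module.Basis ((Gp × Gp) × (Gm × Gm)) ℂ
    (Bicrossproduct h ⊗[ℂ] Bicrossproduct h) :=
  tensorBasis (arrowBasis h) (arrowBasis h)

/-- The basis `{u x} ⊗ ({v y} ⊗ {w z})` of `H ⊗ (H ⊗ H)`, indexed by `((u, v, w), (x, y, z))`. -/
noncomputable abbrev arrowBasis₃ : Module.Basis ((Gp × Gp × Gp) × (Gm × Gm × Gm)) ℂ
    (Bicrossproduct h ⊗[ℂ] (Bicrossproduct h ⊗[ℂ] Bicrossproduct h)) :=
  tensorBasis (arrowBasis h) (arrowBasis₂ h)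

theorem repr_arrowBasis₂ (R : Bicrossproduct h ⊗[ℂ] Bicrossproduct h) (u v : Gp) (x y : Gm) :
    (arrowBasis₂ h).repr R ((u, v), (x, y)) =
      ((basis h).tensorProduct (basis h)).repr R ((u : G) * x, (v : G) * y) := by
  induction R with
  | zero => simp
  | add R R' hR hR' => simp only [map_add, Finsupp.add_apply, hR, hR']
  | tmul a b =>
    simp only [tensorBasis, arrowBasis, Module.Basis.repr_reindex_apply,
      Equiv.prodProdProdComm_symm, Equiv.prodProdProdComm_apply,
      Module.Basis.tensorProduct_repr_tmul_apply]
    rfl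

end ArrowBasis

section TensorSum

variable {G : Type*} [Group G] [Finite G] {Gp Gm : Subgroup G} (h : Gp.IsComplement' Gm)

theorem isActionBasis_arrowBasis : IsActionBasis (posRight h) (arrowBasis h) where
  act_one u := (act_one h u).2
  act_mul u x y := (act_mul h u x y).2
  mul_eq u x v y := by
    simp only [arrowBasis_apply]
    convert basis_mul_basis' h u v x y
  one_eq := by simp [graphSum, arrowBasis_apply, one_def]

theorem isActionBasis_arrowBasis₂ :
    IsActionBasis (fun (p : Gp × Gp) (q : Gm × Gm) => (posRight h p.1 q.1, posRight h p.2 q.2))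
      (arrowBasis₂ h) :=
  (isActionBasis_arrowBasis h).tensor (isActionBasis_arrowBasis h)

theorem isActionBasis_arrowBasis₃ :
    IsActionBasis (k := ℂ) (S := Bicrossproduct h ⊗[ℂ] (Bicrossproduct h ⊗[ℂ] Bicrossproduct h))
      (fun (p : Gp × Gp × Gp) (q : Gm × Gm × Gm) =>
      (posRight h p.1 q.1, posRight h p.2.1 q.2.1, posRight h p.2.2 q.2.2)) (arrowBasis₃ h) :=
  (isActionBasis_arrowBasis h).tensor (isActionBasis_arrowBasis₂ h)

theorem comul_arrowBasis (t : Gp) (x : Gm) : Coalgebra.comul (R := ℂ) (arrowBasis h (t, x)) =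
    ∑ u : Gp, arrowBasis h (t * u⁻¹, negLeft h u x) ⊗ₜ[ℂ] arrowBasis h (u, x) := by
  simp only [arrowBasis_apply, comul_def, comulLin_basis]

open Classical in
theorem comul_arrowBasis_eq_graphSum (t : Gp) (x : Gm) :
    Coalgebra.comul (R := ℂ) (arrowBasis h (t, x)) =
      graphSum (arrowBasis₂ h) (fun p => if p.1 * p.2 = t then 1 else 0)
        fun p => (negLeft h p.2 x, x) := by
  simp only [comul_arrowBasis, graphSum, Fintype.sum_prod_type, tensorBasis_apply, ite_smul,
    one_smul, zero_smul, ← eq_mul_inv_iff_mul_eq]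
  rw [Finset.sum_comm]
  simp

/-- The element `∑ c(u, v) {u A(u, v)} ⊗ {v B(u, v)}` of `H ⊗ H`. -/
noncomputable def tensorSum (c : Gp → Gp → ℂ) (A B : Gp → Gp → Gm) :
    Bicrossproduct h ⊗[ℂ] Bicrossproduct h :=
  graphSum (arrowBasis₂ h) (fun p => c p.1 p.2) fun p => (A p.1 p.2, B p.1 p.2)

variable (c : Gp → Gp → ℂ) (A B : Gp → Gp → Gm)

theorem tensorSum_eq_sum : tensorSum h c A B =
    ∑ u, ∑ v, c u v • (arrowBasis h (u, A u v) ⊗ₜ[ℂ] arrowBasis h (v, B u v)) := by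
  simp only [tensorSum, graphSum, Fintype.sum_prod_type, tensorBasis_apply]

theorem comul_rTensor_tensorSum :
    TensorProduct.assoc ℂ _ _ _ ((Coalgebra.comul (R := ℂ) (A := Bicrossproduct h)).rTensor _
      (tensorSum h c A B)) =
    graphSum (arrowBasis₃ h) (fun p => c (p.1 * p.2.1) p.2.2) fun p =>
      (negLeft h p.2.1 (A (p.1 * p.2.1) p.2.2), A (p.1 * p.2.1) p.2.2, B (p.1 * p.2.1) p.2.2) := by
  simp only [tensorSum_eq_sum, map_sum, map_smul, LinearMap.rTensor_tmul, comul_arrowBasis,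
    TensorProduct.sum_tmul, TensorProduct.assoc_tmul, Finset.smul_sum, graphSum,
    Fintype.sum_prod_type, tensorBasis_apply]
  have swap (t : Gp) := Finset.sum_comm (s := Finset.univ) (t := Finset.univ)
    (f := fun v u : Gp => c t v • (arrowBasis h (t * u⁻¹, negLeft h u (A t v)) ⊗ₜ[ℂ]
      (arrowBasis h (u, A t v) ⊗ₜ[ℂ] arrowBasis h (v, B t v))))
  simp only [swap]
  rw [← sum_sum_mul_right]
  simp only [mul_inv_cancel_right]

theorem comul_lTensor_tensorSum :
    (Coalgebra.comul (R := ℂ) (A := Bicrossproduct h)).lTensor _ (tensorSum h c A B) =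
    graphSum (arrowBasis₃ h) (fun p => c p.1 (p.2.1 * p.2.2)) fun p =>
      (A p.1 (p.2.1 * p.2.2), negLeft h p.2.2 (B p.1 (p.2.1 * p.2.2)), B p.1 (p.2.1 * p.2.2)) := by
  simp only [tensorSum_eq_sum, map_sum, map_smul, LinearMap.lTensor_tmul, comul_arrowBasis,
    TensorProduct.tmul_sum, Finset.smul_sum, graphSum, Fintype.sum_prod_type, tensorBasis_apply]
  refine Finset.sum_congr rfl fun u _ => ?_
  rw [← sum_sum_mul_right]
  simp only [mul_inv_cancel_right]

theorem tensorSum_13 :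
    Algebra.TensorProduct.map (AlgHom.id ℂ (Bicrossproduct h)) Algebra.TensorProduct.includeRight
        (tensorSum h c A B) =
      graphSum (arrowBasis₃ h) (fun p => c p.1 p.2.2) fun p => (A p.1 p.2.2, 1, B p.1 p.2.2) := by
  simp only [tensorSum_eq_sum, map_sum, map_smul, Algebra.TensorProduct.map_tmul, AlgHom.coe_id,
    id_eq, Algebra.TensorProduct.includeRight_apply, (isActionBasis_arrowBasis h).one_eq, graphSum,
    Fintype.sum_prod_type, tensorBasis_apply, TensorProduct.sum_tmul, TensorProduct.tmul_sum,
    Finset.smul_sum, Pi.one_apply, one_smul]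
  exact Finset.sum_congr rfl fun u _ => Finset.sum_comm

theorem tensorSum_23 :
    (Algebra.TensorProduct.includeRight : _ →ₐ[ℂ] Bicrossproduct h ⊗[ℂ] _) (tensorSum h c A B) =
      graphSum (arrowBasis₃ h) (fun p => c p.2.1 p.2.2) fun p =>
        (1, A p.2.1 p.2.2, B p.2.1 p.2.2) := by
  simp only [tensorSum_eq_sum, map_sum, map_smul,
    Algebra.TensorProduct.includeRight_apply, (isActionBasis_arrowBasis h).one_eq, graphSum,
    Fintype.sum_prod_type, tensorBasis_apply, TensorProduct.sum_tmul,
    Finset.smul_sum, Pi.one_apply, one_smul]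
  conv_rhs => rw [Finset.sum_comm]
  exact Finset.sum_congr rfl fun v _ => Finset.sum_comm

theorem tensorSum_12 :
    Algebra.TensorProduct.map (AlgHom.id ℂ (Bicrossproduct h)) Algebra.TensorProduct.includeLeft
        (tensorSum h c A B) =
      graphSum (arrowBasis₃ h) (fun p => c p.1 p.2.1) fun p => (A p.1 p.2.1, B p.1 p.2.1, 1) := by
  simp only [tensorSum_eq_sum, map_sum, map_smul, Algebra.TensorProduct.map_tmul, AlgHom.coe_id,
    id_eq, Algebra.TensorProduct.includeLeft_apply, (isActionBasis_arrowBasis h).one_eq, graphSum,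
    Fintype.sum_prod_type, tensorBasis_apply, TensorProduct.tmul_sum,
    Finset.smul_sum, Pi.one_apply, one_smul]

theorem lid_counit_tensorSum :
    TensorProduct.lid ℂ _ ((Coalgebra.counit (R := ℂ) (A := Bicrossproduct h)).rTensor _
      (tensorSum h c A B)) = graphSum (arrowBasis h) (c 1) (B 1) := by
  classical
  simp [tensorSum_eq_sum, graphSum, arrowBasis_apply, counit_def, counitLin_basis]

theorem rid_counit_tensorSum :
    TensorProduct.rid ℂ _ ((Coalgebra.counit (R := ℂ) (A := Bicrossproduct h)).lTensor _
      (tensorSum h c A B)) = graphSum (arrowBasis h) (c · 1) (A · 1) := by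
  classical
  simp [tensorSum_eq_sum, graphSum, arrowBasis_apply, counit_def, counitLin_basis]

end TensorSum

section QuasiTriangularFamily

variable {G : Type*} [Group G] {Gp Gm : Subgroup G} (h : Gp.IsComplement' Gm)

/-- The quasi-triangularity axioms, in the order of `IsQuasiTriangular`, for
`R = ∑ c(u, v) {u A(u, v)} ⊗ {v B(u, v)}`, read off coefficient by coefficient. -/
structure IsQuasiTriangularFamily (c : Gp → Gp → ℂ) (A B : Gp → Gp → Gm) : Prop where
  conj : ∀ u v, posRight h u (A u v) * posRight h v (B u v) = v * u ∧ ∀ x,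
    c (posRight h u x) (posRight h v (negLeft h u x)) = c u v ∧
    x * A (posRight h u x) (posRight h v (negLeft h u x)) =
      A u v * negLeft h (posRight h v (B u v)) x ∧
    negLeft h u x * B (posRight h u x) (posRight h v (negLeft h u x)) = B u v * x
  comul_left : ∀ u v w, c (u * v) w = c u w * c v (posRight h w (B u w)) ∧
    negLeft h v (A (u * v) w) = A u w ∧ A (u * v) w = A v (posRight h w (B u w)) ∧
    B (u * v) w = B u w * B v (posRight h w (B u w))
  comul_right : ∀ u v w, c u (v * w) = c u w * c (posRight h u (A u w)) v ∧
    A u (v * w) = A u w * A (posRight h u (A u w)) v ∧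
    negLeft h w (B u (v * w)) = B (posRight h u (A u w)) v ∧ B u (v * w) = B u w
  counit_left : ∀ v, c 1 v = 1 ∧ B 1 v = 1
  counit_right : ∀ u, c u 1 = 1 ∧ A u 1 = 1

variable [Finite G] {c : Gp → Gp → ℂ} {A B : Gp → Gp → Gm}

open Classical in
theorem tensorSum_mul_comul_arrowBasis (c : Gp → Gp → ℂ) (A B : Gp → Gp → Gm) (t : Gp) (x : Gm) :
    tensorSum h c A B * Coalgebra.comul (R := ℂ) (arrowBasis h (t, x)) =
      graphSum (arrowBasis₂ h)
        (fun p => if posRight h p.1 (A p.1 p.2) * posRight h p.2 (B p.1 p.2) = t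
          then c p.1 p.2 else 0)
        fun p => (A p.1 p.2 * negLeft h (posRight h p.2 (B p.1 p.2)) x, B p.1 p.2 * x) := by
  simp only [tensorSum, comul_arrowBasis_eq_graphSum,
    (isActionBasis_arrowBasis₂ h).graphSum_mul_graphSum, mul_ite, mul_one, mul_zero, Prod.mk_mul_mk]

open Classical in
theorem comm_comul_arrowBasis_mul_tensorSum (c : Gp → Gp → ℂ) (A B : Gp → Gp → Gm) (t : Gp)
    (x : Gm) :
    TensorProduct.comm ℂ _ _ (Coalgebra.comul (R := ℂ) (arrowBasis h (t, x))) *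
        tensorSum h c A B =
      graphSum (arrowBasis₂ h)
        (fun p => if p.2 * p.1 = t
          then c (posRight h p.1 x) (posRight h p.2 (negLeft h p.1 x)) else 0)
        fun p => (x * A (posRight h p.1 x) (posRight h p.2 (negLeft h p.1 x)),
          negLeft h p.1 x * B (posRight h p.1 x) (posRight h p.2 (negLeft h p.1 x))) := by
  have comm_comul : TensorProduct.comm ℂ _ _ (Coalgebra.comul (R := ℂ) (arrowBasis h (t, x))) =
      graphSum (arrowBasis₂ h) (fun p => if p.2 * p.1 = t then 1 else 0)
        fun p => (x, negLeft h p.1 x) := by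
    simp only [comul_arrowBasis_eq_graphSum, graphSum, map_sum, map_smul, tensorBasis_apply,
      TensorProduct.comm_tmul, Fintype.sum_prod_type]
    exact Finset.sum_comm
  simp only [tensorSum, comm_comul, (isActionBasis_arrowBasis₂ h).graphSum_mul_graphSum, ite_mul,
    one_mul, zero_mul, Prod.mk_mul_mk]

variable {h}

theorem comm_comul_mul_tensorSum_iff (hc : ∀ u v, c u v ≠ 0) :
    (∀ a : Bicrossproduct h, TensorProduct.comm ℂ _ _ (Coalgebra.comul (R := ℂ) a) *
      tensorSum h c A B = tensorSum h c A B * Coalgebra.comul (R := ℂ) a) ↔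
    ∀ u v, posRight h u (A u v) * posRight h v (B u v) = v * u ∧ ∀ x,
      c (posRight h u x) (posRight h v (negLeft h u x)) = c u v ∧
      x * A (posRight h u x) (posRight h v (negLeft h u x)) =
        A u v * negLeft h (posRight h v (B u v)) x ∧
      negLeft h u x * B (posRight h u x) (posRight h v (negLeft h u x)) = B u v * x := by
  classical
  have reduce_to_basis :
      (∀ a : Bicrossproduct h, TensorProduct.comm ℂ _ _ (Coalgebra.comul (R := ℂ) a) *
        tensorSum h c A B = tensorSum h c A B * Coalgebra.comul (R := ℂ) a) ↔
      ∀ t x, TensorProduct.comm ℂ _ _ (Coalgebra.comul (R := ℂ) (arrowBasis h (t, x))) *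
        tensorSum h c A B = tensorSum h c A B *
          Coalgebra.comul (R := ℂ) (arrowBasis h (t, x)) := by
    exact ⟨fun e t x => e _, fun e => LinearMap.congr_fun (f :=
      LinearMap.mulRight ℂ (tensorSum h c A B) ∘ₗ (TensorProduct.comm ℂ _ _).toLinearMap ∘ₗ
        Coalgebra.comul) (g := LinearMap.mulLeft ℂ (tensorSum h c A B) ∘ₗ Coalgebra.comul)
      ((arrowBasis h).ext fun p => e p.1 p.2)⟩
  simp only [reduce_to_basis, tensorSum_mul_comul_arrowBasis, comm_comul_arrowBasis_mul_tensorSum,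
    graphSum_eq_graphSum_iff, Prod.forall, Prod.mk.injEq]
  constructor
  · intro e u v
    have hvu : posRight h u (A u v) * posRight h v (B u v) = v * u := by
      by_contra hne
      have e₁ := (e (v * u) 1 u v).1
      rw [if_pos rfl, if_neg hne] at e₁
      exact hc _ _ e₁
    refine ⟨hvu, fun x => ?_⟩
    have e' := e (v * u) x u v
    rw [if_pos rfl, if_pos hvu] at e'
    exact ⟨e'.1, e'.2 (hc _ _)⟩
  · intro e t x u v
    obtain ⟨hvu, e⟩ := e u v
    rw [hvu, (e x).1]
    exact ⟨rfl, fun _ => (e x).2⟩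

theorem comul_rTensor_tensorSum_iff (hc : ∀ u v, c u v ≠ 0) :
    TensorProduct.assoc ℂ _ _ _ ((Coalgebra.comul (R := ℂ) (A := Bicrossproduct h)).rTensor _
        (tensorSum h c A B)) =
      Algebra.TensorProduct.map (AlgHom.id ℂ _) Algebra.TensorProduct.includeRight
        (tensorSum h c A B) *
      (Algebra.TensorProduct.includeRight : _ →ₐ[ℂ] Bicrossproduct h ⊗[ℂ] _)
        (tensorSum h c A B) ↔
    ∀ u v w, c (u * v) w = c u w * c v (posRight h w (B u w)) ∧
      negLeft h v (A (u * v) w) = A u w ∧ A (u * v) w = A v (posRight h w (B u w)) ∧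
      B (u * v) w = B u w * B v (posRight h w (B u w)) := by
  rw [comul_rTensor_tensorSum, tensorSum_13, tensorSum_23,
    (isActionBasis_arrowBasis₃ h).graphSum_mul_graphSum,
    graphSum_eq_graphSum_iff_of_ne_zero _ fun _ => hc _ _]
  simp only [Prod.forall, Prod.mk.injEq, Prod.mk_mul_mk, (act_one h _).2, mul_one, one_mul]

theorem comul_lTensor_tensorSum_iff (hc : ∀ u v, c u v ≠ 0) :
    (Coalgebra.comul (R := ℂ) (A := Bicrossproduct h)).lTensor _ (tensorSum h c A B) =
      Algebra.TensorProduct.map (AlgHom.id ℂ _) Algebra.TensorProduct.includeRight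
        (tensorSum h c A B) *
      Algebra.TensorProduct.map (AlgHom.id ℂ _) Algebra.TensorProduct.includeLeft
        (tensorSum h c A B) ↔
    ∀ u v w, c u (v * w) = c u w * c (posRight h u (A u w)) v ∧
      A u (v * w) = A u w * A (posRight h u (A u w)) v ∧
      negLeft h w (B u (v * w)) = B (posRight h u (A u w)) v ∧ B u (v * w) = B u w := by
  rw [comul_lTensor_tensorSum, tensorSum_13, tensorSum_12,
    (isActionBasis_arrowBasis₃ h).graphSum_mul_graphSum,
    graphSum_eq_graphSum_iff_of_ne_zero _ fun _ => hc _ _]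
  simp only [Prod.forall, Prod.mk.injEq, Prod.mk_mul_mk, (act_one h _).2, mul_one, one_mul]

theorem lid_counit_tensorSum_eq_one_iff (hc : ∀ u v, c u v ≠ 0) :
    TensorProduct.lid ℂ _ ((Coalgebra.counit (R := ℂ) (A := Bicrossproduct h)).rTensor _
      (tensorSum h c A B)) = 1 ↔ ∀ v, c 1 v = 1 ∧ B 1 v = 1 := by
  rw [lid_counit_tensorSum, (isActionBasis_arrowBasis h).one_eq,
    graphSum_eq_graphSum_iff_of_ne_zero _ (hc 1)]
  rfl

theorem rid_counit_tensorSum_eq_one_iff (hc : ∀ u v, c u v ≠ 0) :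
    TensorProduct.rid ℂ _ ((Coalgebra.counit (R := ℂ) (A := Bicrossproduct h)).lTensor _
      (tensorSum h c A B)) = 1 ↔ ∀ u, c u 1 = 1 ∧ A u 1 = 1 := by
  rw [rid_counit_tensorSum, (isActionBasis_arrowBasis h).one_eq,
    graphSum_eq_graphSum_iff_of_ne_zero _ (hc · 1)]
  rfl

instance : Module.Finite ℂ (Bicrossproduct h) := Module.Finite.of_basis (basis h)

theorem isQuasiTriangular_tensorSum_iff (hc : ∀ u v, c u v ≠ 0) :
    IsQuasiTriangular (tensorSum h c A B) ↔ IsQuasiTriangularFamily h c A B := by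
  constructor
  · intro hR
    obtain ⟨U, hU, conj⟩ := hR.conj
    refine ⟨(comm_comul_mul_tensorSum_iff hc).1 fun a => ?_,
      (comul_rTensor_tensorSum_iff hc).1 hR.comul_left,
      (comul_lTensor_tensorSum_iff hc).1 hR.comul_right,
      (lid_counit_tensorSum_eq_one_iff hc).1 hR.counit_left,
      (rid_counit_tensorSum_eq_one_iff hc).1 hR.counit_right⟩
    rw [← hU, conj, U.inv_mul_cancel_right]
  · intro hF
    have comul_left := (comul_rTensor_tensorSum_iff hc).2 hF.comul_left
    have counit_left := (lid_counit_tensorSum_eq_one_iff (h := h) (A := A) hc).2 hF.counit_left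
    have inv_mul := antipode_rTensor_mul_self comul_left counit_left
    have : IsNoetherianRing (Bicrossproduct h ⊗[ℂ] Bicrossproduct h) :=
      IsNoetherianRing.of_finite ℂ _
    exact ⟨⟨⟨tensorSum h c A B, _, mul_eq_one_comm.1 inv_mul, inv_mul⟩, rfl, fun a =>
      Units.eq_mul_inv_iff_mul_eq _ |>.2 ((comm_comul_mul_tensorSum_iff hc).2 hF.conj a)⟩,
      comul_left, (comul_lTensor_tensorSum_iff hc).2 hF.comul_right, counit_left,
      (rid_counit_tensorSum_eq_one_iff hc).2 hF.counit_right⟩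

end QuasiTriangularFamily

namespace IsQuasiTriangularFamily

variable {G : Type*} [Group G] {Gp Gm : Subgroup G} {h : Gp.IsComplement' Gm}
  {c : Gp → Gp → ℂ} {A B : Gp → Gp → Gm}

theorem right_eq (hF : IsQuasiTriangularFamily h c A B) (u v : Gp) : B u v = B u 1 := by
  simpa using (hF.comul_right u v 1).2.2.2

theorem left_eq (hF : IsQuasiTriangularFamily h c A B) (u v : Gp) :
    A u v = A 1 (posRight h v (B u v)) := by
  simpa using (hF.comul_left u 1 v).2.2.1

theorem coeff_eq_one [Finite G] (hF : IsQuasiTriangularFamily h c A B) (hc : ∀ u v, 0 < c u v)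
    (u v : Gp) : c u v = 1 := by
  have := Fintype.ofFinite Gp
  let prodHom : Gp →* ℂ :=
    { toFun := fun u => ∏ v, c u v
      map_one' := Finset.prod_eq_one fun v _ => (hF.counit_left v).1
      map_mul' := fun u w => by
        simp only [(hF.comul_left _ _ _).1, Finset.prod_mul_distrib, hF.right_eq u]
        congr 1
        exact (posRight_bijective h (B u 1)).prod_comp (c w) }
  have prod_eq_one (u : Gp) : ∏ v, c u v = 1 := by
    have prod_pow : prodHom u ^ Nat.card Gp = 1 := by rw [← map_pow, pow_card_eq_one', map_one]
    exact eq_one_of_pos_of_pow_eq_one (Finset.prod_pos fun v _ => hc u v) Nat.card_pos.ne' prod_pow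
  have prod_shift : ∏ w, c u (w * v) = ∏ w, c u w := Equiv.prod_comp (Equiv.mulRight v) (c u)
  simp only [(hF.comul_right _ _ _).1, Finset.prod_mul_distrib, prod_eq_one, mul_one,
    Finset.prod_const] at prod_shift
  exact eq_one_of_pos_of_pow_eq_one (hc u v) (Finset.card_ne_zero.2 Finset.univ_nonempty)
    prod_shift

theorem exists_isCompatible (hF : IsQuasiTriangularFamily h c A B) :
    ∃ ξ η : Gp →* Gm, IsCompatible h ξ η ∧
      (∀ u v, A u v = (η (posRight h v (ξ u)))⁻¹) ∧ ∀ u v, B u v = ξ u := by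
  let ξ : Gp →* Gm := MonoidHom.mk' (fun u => B u 1) fun u w => by
    rw [(hF.comul_left u w 1).2.2.2, hF.right_eq w]
  let η : Gp →* Gm := MonoidHom.mk' (fun v => (A 1 v)⁻¹) fun v w => by
    rw [(hF.comul_right 1 v w).2.1, (one_act h _).2, mul_inv_rev]
  have B_eq (u v : Gp) : B u v = ξ u := hF.right_eq u v
  have A_eq (u v : Gp) : A u v = (η (posRight h v (ξ u)))⁻¹ := by
    rw [hF.left_eq, B_eq]
    exact (inv_inv _).symm
  refine ⟨ξ, η, ⟨fun u x => ?_, fun v x => ?_, fun u v => ?_⟩, A_eq, B_eq⟩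
  · obtain ⟨-, -, e⟩ := (hF.conj u 1).2 x
    simpa only [B_eq] using e.symm
  · obtain ⟨-, e, -⟩ := (hF.conj 1 v).2 x
    simp only [A_eq, B_eq, (one_act h _).1, (one_act h _).2, map_one, (act_one h _).2] at e
    rwa [mul_inv_eq_iff_eq_mul, mul_assoc, eq_inv_mul_iff_mul_eq] at e
  · have e := (hF.conj u (posRight h v (ξ u)⁻¹)).1
    rwa [A_eq, B_eq, ← (act_mul h _ _ _).2, inv_mul_cancel, (act_one h _).2] at e

end IsQuasiTriangularFamily

section RMatrix

variable {G : Type*} [Group G] {Gp Gm : Subgroup G} {h : Gp.IsComplement' Gm} {ξ η : Gp →* Gm}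

theorem isQuasiTriangularFamily_of_isCompatible (H : IsCompatible h ξ η) :
    IsQuasiTriangularFamily h 1 (fun u v => (η (posRight h v (ξ u)))⁻¹) fun u _ => ξ u where
  conj u v := by
    have mul_map_inv (x : Gm) (w : Gp) :
        x * (η (posRight h w x))⁻¹ = (η w)⁻¹ * negLeft h w x := by
      rw [mul_inv_eq_iff_eq_mul, mul_assoc, ← H.right, inv_mul_cancel_left]
    refine ⟨H.posRight_mul_posRight u v, fun x => ⟨rfl, ?_, (H.left u x).symm⟩⟩
    rw [← (act_mul h _ _ _).2, ← H.left, (act_mul h _ _ _).2]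
    exact mul_map_inv x _
  comul_left u v w := by
    simp only [map_mul, (act_mul h _ _ _).2, H.negLeft_inv_map, Pi.one_apply, mul_one, and_self]
  comul_right u v w := by
    refine ⟨(mul_one 1).symm, ?_, H.negLeft_map u w, rfl⟩
    rw [← mul_inv_rev, ← map_mul, (mul_act h v w _).2, H.negLeft_map]
  counit_left v := ⟨rfl, map_one ξ⟩
  counit_right u := ⟨rfl, by simp only [(one_act h _).2, map_one, inv_one]⟩

variable [Finite G]

theorem rMatrix_eq_tensorSum (H : IsCompatible h ξ η) : rMatrix h ξ η =
    tensorSum h 1 (fun u v => (η (posRight h v (ξ u)))⁻¹) fun u _ => ξ u := by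
  simp only [rMatrix, tensorSum_eq_sum, arrowBasis_apply, H.negRight_map_inv, Pi.one_apply,
    one_smul]

theorem isPositive_iff {R : Bicrossproduct h ⊗[ℂ] Bicrossproduct h} :
    IsPositive h R ↔ ∀ g k, 0 ≤ ((basis h).tensorProduct (basis h)).repr R (g, k) := by
  simp only [IsPositive, RCLike.nonneg_iff_exists_ofReal (K := ℂ), eq_comm]
  rfl

theorem isPositive_tensorSum {c : Gp → Gp → ℂ} (hc : ∀ u v, 0 ≤ c u v) (A B : Gp → Gp → Gm) :
    IsPositive h (tensorSum h c A B) := by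
  refine isPositive_iff.2 fun g k => ?_
  obtain ⟨u, x, rfl⟩ := exists_eq h g
  obtain ⟨v, y, rfl⟩ := exists_eq h k
  rw [← repr_arrowBasis₂, tensorSum, repr_graphSum]
  split_ifs
  exacts [hc u v, le_rfl]

theorem repr_antipode_rTensor (R : Bicrossproduct h ⊗[ℂ] Bicrossproduct h) (g k : G) :
    ((basis h).tensorProduct (basis h)).repr
      ((HopfAlgebra.antipode ℂ (A := Bicrossproduct h)).rTensor _ R) (g, k) =
    ((basis h).tensorProduct (basis h)).repr R (g⁻¹, k) := by
  have repr_antipode (a : Bicrossproduct h) :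
      (basis h).repr (HopfAlgebra.antipode ℂ a) g = (basis h).repr a g⁻¹ := by
    change (basis h).repr (antipodeLin h a) g = _
    induction a using induct with
    | hadd a b ha hb => simp only [map_add, Finsupp.add_apply, ha, hb]
    | hsmul r a ha => simp only [map_smul, Finsupp.smul_apply, ha]
    | hof l =>
      classical
      simp only [antipodeLin_basis, Module.Basis.repr_self, Finsupp.single_apply, inv_eq_iff_eq_inv]
  induction R with
  | zero => simp
  | add R R' hR hR' => simp only [map_add, Finsupp.add_apply, hR, hR']
  | tmul a b =>
    simp only [LinearMap.rTensor_tmul, Module.Basis.tensorProduct_repr_tmul_apply, repr_antipode]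

theorem IsPositive.exists_eq_tensorSum {R : Bicrossproduct h ⊗[ℂ] Bicrossproduct h}
    (hpos : IsPositive h R) (hR : IsQuasiTriangular R) :
    ∃ (c : Gp → Gp → ℂ) (A B : Gp → Gp → Gm), (∀ u v, 0 < c u v) ∧ R = tensorSum h c A B := by
  have nonneg := isPositive_iff.1 hpos
  have inv_mul := antipode_rTensor_mul_self hR.comul_left hR.counit_left
  obtain ⟨U, rfl, -⟩ := hR.conj
  have mul_inv := U.mul_eq_one_iff_inv_eq.2 (U.mul_eq_one_iff_eq_inv.1 inv_mul).symm
  obtain ⟨c, M, hc, e⟩ := (isActionBasis_arrowBasis₂ h).exists_eq_graphSum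
    (fun p => by rw [repr_arrowBasis₂]; exact nonneg _ _)
    (fun p => by rw [repr_arrowBasis₂, repr_antipode_rTensor]; exact nonneg _ _) mul_inv inv_mul
  exact ⟨fun u v => c (u, v), fun u v => (M (u, v)).1, fun u v => (M (u, v)).2, fun _ _ => hc _, e⟩

end RMatrix

end Bicrossproduct

theorem theorem1 {G : Type*} [Group G] [Finite G] {Gp Gm : Subgroup G}
    (h : Gp.IsComplement' Gm) :
    (∀ ξ η : Gp →* Gm, IsRDatum ξ η →
      IsQuasiTriangular (k := ℂ) (Bicrossproduct.rMatrix h ξ η) ∧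
        Bicrossproduct.IsPositive h (Bicrossproduct.rMatrix h ξ η)) ∧
    (∀ R : Bicrossproduct h ⊗[ℂ] Bicrossproduct h,
      IsQuasiTriangular (k := ℂ) R → Bicrossproduct.IsPositive h R →
        ∃ ξ η : Gp →* Gm, IsRDatum ξ η ∧ R = Bicrossproduct.rMatrix h ξ η) := by
  refine ⟨fun ξ η H => ?_, fun R hR hpos => ?_⟩
  · have hcomp := UniqueFactorization.isCompatible_of_isRDatum h H
    rw [Bicrossproduct.rMatrix_eq_tensorSum hcomp]
    exact ⟨(Bicrossproduct.isQuasiTriangular_tensorSum_iff fun _ _ => one_ne_zero).2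
        (Bicrossproduct.isQuasiTriangularFamily_of_isCompatible hcomp),
      Bicrossproduct.isPositive_tensorSum (fun _ _ => zero_le_one) _ _⟩
  · obtain ⟨c, A, B, hc, rfl⟩ := hpos.exists_eq_tensorSum hR
    have hF := (Bicrossproduct.isQuasiTriangular_tensorSum_iff fun u v => (hc u v).ne').1 hR
    obtain ⟨ξ, η, hcomp, hA, hB⟩ := hF.exists_isCompatible
    refine ⟨ξ, η, hcomp.isRDatum, ?_⟩
    rw [Bicrossproduct.rMatrix_eq_tensorSum hcomp]
    congr 1 <;> funext u v
    exacts [hF.coeff_eq_one hc u v, hA u v, hB u v]
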